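/- Let $K_{1,3}^{**}$ be the graph with six vertices $c, x_1, x_2, x_3, y_1, y_2$ and the five edges $cx_1, cx_2, cx_3, x_1y_1, x_2y_2$, and let $Z_1$ be the graph obtained from a triangle by adding one new vertex joined to exactly one vertex of the triangle. Let $G$ be a finite simple graph that is $2$-connected (that is, $G$ has at least three vertices, is connected, and stays connected after the deletion of any one vertex) and that contains neither $K_{1,3}^{**}$ nor $Z_1$ as an induced subgraph. Then $G$ has a longest cycle $C$ (a cycle of maximum length among all cycles of $G$) that is dominating, i.e. every edge of $G$ is incident with a vertex of $C$. -/

import Mathlib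

namespace SimpleGraph

universe u

/-- `G` is `k`-connected: it has more than `k` vertices, and deleting any set of fewer than `k`
vertices leaves a connected graph. -/
def IsKConnected {V : Type u} [Fintype V] (G : SimpleGraph V) (k : ℕ) : Prop :=
  k < Fintype.card V ∧
    ∀ X : Finset V, X.card < k → (G.induce {v : V | v ∉ X}).Connected

/-- The closed walk `C` is a longest cycle of `G`. -/
def IsLongestCycle {V : Type u} (G : SimpleGraph V) {v : V} (C : G.Walk v v) : Prop :=
  C.IsCycle ∧ ∀ (w : V) (D : G.Walk w w), D.IsCycle → D.length ≤ C.length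

/-- The cycle `C` is a dominating cycle of `G`: every edge of `G` is incident with a vertex
of `C`. -/
def IsDominatingCycle {V : Type u} (G : SimpleGraph V) {v : V} (C : G.Walk v v) : Prop :=
  C.IsCycle ∧ ∀ e ∈ G.edgeSet, ∃ x ∈ C.support, x ∈ e

/-- `G` is `H`-free: `G` has no induced subgraph isomorphic to `H`. -/
def IsInducedFree {V : Type u} (G : SimpleGraph V) {n : ℕ} (H : SimpleGraph (Fin n)) : Prop :=
  ¬ H.IsIndContained G

end SimpleGraph

/-- `K_{1,3}^{**}`: the claw with centre `0` and leaves `1`, `2`, `3`, together with a pendant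
edge at each of the two leaves `1` and `2`. -/
def clawTwoPendant : SimpleGraph (Fin 6) :=
  SimpleGraph.fromEdgeSet {s(0, 1), s(0, 2), s(0, 3), s(1, 4), s(2, 5)}

/-- `Z_1`: the triangle on `0`, `1`, `2` together with a pendant edge at `0`. -/
def triangleOnePendant : SimpleGraph (Fin 4) :=
  SimpleGraph.fromEdgeSet {s(0, 1), s(0, 2), s(1, 2), s(0, 3)}

/-! Suppose an edge uv misses a longest cycle C, where C leaves as few edges uncovered as possible
among the longest cycles. If G has a triangle, connectivity and the absence of an induced Z_1 make
every vertex adjacent to an end of every other edge (`NoPaw.adj_or_adj`); then u, v or both fit into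
an edge of C (`dominating_of_adj_or_adj`).

Otherwise let H be the component of G - C containing uv. By 2-connectivity, two vertices x, y of C
have distinct neighbours in H; they are chosen so that the stretch A of C from x to y has no
neighbour in H. Let z be the last vertex with a neighbour in H before C returns to x, and B the
stretch after z. An induced path w', w, x with w', w in H serves as the leg of a spider: without
induced spiders, consecutive distance levels from w' are completely joined, as far as vertices away
from H are concerned (`adj_iff_consecutiveLevels_dist`). So whichever of A and B reaches no higher
can be absorbed by the other in pairs (`exists_insert_list`), while a path through H takes its place
on C. If parity forbids absorbing all of it, a second detour vertex, an extra uncovered vertex or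
the count of uncovered edges still gives a contradiction (`IsLeveledCycle.absurd_of_levels_le`). -/

namespace SimpleGraph

universe u
variable {V : Type u}

/-! ### Cycles as lists -/

/-- The list `x :: R` runs once around a cycle of `G`. -/
def IsListCycle (G : SimpleGraph V) (x : V) (R : List V) : Prop :=
  (x :: R).Nodup ∧ 2 ≤ R.length ∧ List.IsChain G.Adj (x :: (R ++ [x]))

lemma IsListCycle.rotate {G : SimpleGraph V} {x y : V} {A B : List V}
    (h : G.IsListCycle x (A ++ y :: B)) : G.IsListCycle y (B ++ x :: A) := by
  obtain ⟨h1, h2, h3⟩ := h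
  refine ⟨?_, by simp at h2 ⊢; omega, ?_⟩
  · refine (List.Perm.nodup_iff ?_).1 h1
    have := List.perm_append_comm (l₁ := x :: A) (l₂ := y :: B)
    simpa using this
  · have e1 : x :: ((A ++ y :: B) ++ [x]) = (x :: A) ++ y :: (B ++ [x]) := by simp
    have e2 : y :: ((B ++ x :: A) ++ [y]) = (y :: B) ++ x :: (A ++ [y]) := by simp
    rw [e1, List.isChain_split] at h3
    rw [e2, List.isChain_split]
    exact ⟨by simpa using h3.2, by simpa using h3.1⟩

lemma IsListCycle.reverse {G : SimpleGraph V} {x : V} {R : List V}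
    (h : G.IsListCycle x R) : G.IsListCycle x R.reverse := by
  obtain ⟨h1, h2, h3⟩ := h
  refine ⟨by simpa using h1, by simpa using h2, ?_⟩
  have e : x :: (R.reverse ++ [x]) = (x :: (R ++ [x])).reverse := by simp
  rw [e, List.isChain_reverse]
  exact h3.imp fun _ _ hab => hab.symm

lemma IsListCycle.exists_walk {G : SimpleGraph V} {x : V} {R : List V}
    (h : G.IsListCycle x R) :
    ∃ C : G.Walk x x, C.IsCycle ∧ C.length = R.length + 1 ∧ ∀ v, v ∈ C.support ↔ v ∈ x :: R := by
  obtain ⟨h1, h2, h3⟩ := h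
  let C₀ := Walk.ofSupport (x :: (R ++ [x])) (by simp) h3
  let C : G.Walk x x := C₀.copy (by simp) (by simp)
  have hs : C.support = x :: (R ++ [x]) :=
    (Walk.support_copy _ _ _).trans (Walk.support_ofSupport _ _)
  have hl : C.length = R.length + 1 := by
    have := congrArg List.length hs
    simpa using this
  refine ⟨C, ?_, hl, fun v => ?_⟩
  · rw [Walk.isCycle_iff_isPath_tail_and_le_length]
    refine ⟨?_, by omega⟩
    rw [Walk.isPath_def, Walk.support_tail_of_not_nil _ (by
      rw [← Walk.length_eq_zero_iff]; omega), hs]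
    simp only [List.tail_cons]
    refine (List.Perm.nodup_iff ?_).1 h1
    have := List.perm_append_comm (l₁ := [x]) (l₂ := R)
    simpa using this
  · rw [hs]; simp; tauto

lemma Walk.IsCycle.exists_isListCycle {G : SimpleGraph V} {x : V} {C : G.Walk x x}
    (h : C.IsCycle) : ∃ R, G.IsListCycle x R ∧ C.length = R.length + 1 := by
  have h1 := h.nodup_dropLast_support
  have h2 := C.isChain_adj_support
  have h3 := h.three_le_length
  have hl : C.support.length = C.length + 1 := C.length_support
  have hlast : C.support.getLast (by simp) = x := by simp
  have hsplit := List.dropLast_append_getLast (l := C.support) (by simp)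
  rw [hlast] at hsplit
  have hhead : C.support.head (by simp) = x := by simp
  cases hd : C.support.dropLast with
  | nil =>
    have := congrArg List.length hd
    rw [List.length_dropLast, List.length_nil] at this
    omega
  | cons a R =>
    have hlen := congrArg List.length hd
    rw [List.length_dropLast, List.length_cons] at hlen
    rw [hd] at hsplit h1
    have ha : a = x := by
      have : C.support.head? = some x := by
        rw [List.head?_eq_some_head (by simp), hhead]
      rw [← hsplit] at this
      simpa using this
    subst ha
    rw [← hsplit] at h2
    exact ⟨R, ⟨h1, by omega, by simpa using h2⟩, by omega⟩

/-! ### Inserting pairs of vertices into a list of levels -/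

/-- The levels of `u` and `v` are consecutive. -/
def ConsecutiveLevels (f : V → ℕ) (u v : V) : Prop := f u = f v + 1 ∨ f v = f u + 1

lemma ConsecutiveLevels.symm {f : V → ℕ} {u v : V} (h : ConsecutiveLevels f u v) :
    ConsecutiveLevels f v u := Or.symm h

/-- A discrete intermediate value theorem: levels change by exactly one at each step. -/
lemma exists_crossing (f : V → ℕ) (i : ℕ) : ∀ (l : List V),
    l.IsChain (ConsecutiveLevels f) → (∃ b ∈ l, f b ≤ i) → (∃ b ∈ l, i + 1 ≤ f b) →
    ∃ l₁ s t l₂, l = l₁ ++ s :: t :: l₂ ∧ (f s = i ∧ f t = i + 1 ∨ f s = i + 1 ∧ f t = i)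
  | [], _, h, _ => by simp at h
  | [a], _, h1, h2 => by simp at h1 h2; omega
  | a :: b :: l, hc, h1, h2 => by
    have hab : ConsecutiveLevels f a b := hc.rel
    by_cases hc' : f a = i ∧ f b = i + 1 ∨ f a = i + 1 ∧ f b = i
    · exact ⟨[], a, b, l, rfl, hc'⟩
    have key : (∃ c ∈ b :: l, f c ≤ i) ∧ (∃ c ∈ b :: l, i + 1 ≤ f c) := by
      obtain ⟨c, hc1, hc2⟩ := h1
      obtain ⟨d, hd1, hd2⟩ := h2
      unfold ConsecutiveLevels at hab
      rw [List.mem_cons] at hc1 hd1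
      constructor
      · rcases hc1 with rfl | hc1
        · exact ⟨b, by simp, by omega⟩
        · exact ⟨c, hc1, hc2⟩
      · rcases hd1 with rfl | hd1
        · exact ⟨b, by simp, by omega⟩
        · exact ⟨d, hd1, hd2⟩
    obtain ⟨l₁, s, t, l₂, e, h⟩ := exists_crossing f i (b :: l) hc.of_cons key.1 key.2
    exact ⟨a :: l₁, s, t, l₂, by rw [e]; rfl, h⟩

/-- Some step of `B` crosses between the levels of `q` and `r`; between its ends the pair fits in
one of its two orders. The ends of `B` are kept so that the new list still attaches to the rest of
the cycle. -/
lemma exists_insert_pair {f : V → ℕ} {B : List V} (hB : B.IsChain (ConsecutiveLevels f))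
    {q r : V} (hqr : ConsecutiveLevels f q r)
    (hq : ∃ b ∈ B, f q ≤ f b) (hr : ∃ b ∈ B, f r ≤ f b)
    (hq' : ∃ b ∈ B, f b ≤ f q) (hr' : ∃ b ∈ B, f b ≤ f r) :
    ∃ B' : List V, B'.Perm (q :: r :: B) ∧ B'.IsChain (ConsecutiveLevels f) ∧
      B'.head? = B.head? ∧ B'.getLast? = B.getLast? := by
  wlog h : f r = f q + 1 generalizing q r
  · obtain ⟨B', h1, h2⟩ := this hqr.symm hr hq hr' hq' (hqr.resolve_right h)
    exact ⟨B', h1.trans (List.Perm.swap _ _ _), h2⟩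
  obtain ⟨l₁, s, t, l₂, rfl, hst⟩ := exists_crossing f (f q) B hB hq' (by rwa [h] at hr)
  rw [List.isChain_append_cons_cons] at hB
  obtain ⟨hB1, hB2, hB3⟩ := hB
  rcases hst with ⟨hs, ht⟩ | ⟨hs, ht⟩
  · refine ⟨l₁ ++ s :: r :: q :: t :: l₂, ?_, ?_, ?_, ?_⟩
    · have : (l₁ ++ s :: r :: q :: t :: l₂) = (l₁ ++ [s]) ++ ([r, q] ++ (t :: l₂)) := by simp
      rw [this]
      have e : q :: r :: (l₁ ++ s :: t :: l₂) = [q, r] ++ ((l₁ ++ [s]) ++ (t :: l₂)) := by simp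
      rw [e]
      refine (List.perm_append_comm_assoc _ _ _).trans ?_
      exact List.Perm.append_right _ (List.Perm.swap _ _ _)
    · rw [List.isChain_append_cons_cons]
      refine ⟨hB1, ?_, ?_⟩
      · unfold ConsecutiveLevels; omega
      · rw [List.isChain_cons_cons, List.isChain_cons_cons]
        refine ⟨hqr.symm, ?_, hB3⟩
        unfold ConsecutiveLevels; omega
    · cases l₁ <;> simp
    · simp [List.getLast?_append, List.getLast?_cons_cons]
  · refine ⟨l₁ ++ s :: q :: r :: t :: l₂, ?_, ?_, ?_, ?_⟩
    · have : (l₁ ++ s :: q :: r :: t :: l₂) = (l₁ ++ [s]) ++ ([q, r] ++ (t :: l₂)) := by simp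
      rw [this]
      have e : q :: r :: (l₁ ++ s :: t :: l₂) = [q, r] ++ ((l₁ ++ [s]) ++ (t :: l₂)) := by simp
      rw [e]
      exact List.perm_append_comm_assoc _ _ _
    · rw [List.isChain_append_cons_cons]
      refine ⟨hB1, ?_, ?_⟩
      · unfold ConsecutiveLevels; omega
      · rw [List.isChain_cons_cons, List.isChain_cons_cons]
        refine ⟨hqr, ?_, hB3⟩
        unfold ConsecutiveLevels; omega
    · cases l₁ <;> simp
    · simp [List.getLast?_append, List.getLast?_cons_cons]

lemma exists_insert_list {f : V → ℕ} {B : List V} (hB : B.IsChain (ConsecutiveLevels f)) :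
    ∀ A : List V, A.IsChain (ConsecutiveLevels f) → Even A.length →
    (∀ a ∈ A, ∃ b ∈ B, f a ≤ f b) → (∀ a ∈ A, ∃ b ∈ B, f b ≤ f a) →
    ∃ B' : List V, B'.Perm (A ++ B) ∧ B'.IsChain (ConsecutiveLevels f) ∧
      B'.head? = B.head? ∧ B'.getLast? = B.getLast?
  | [], _, _, _, _ => ⟨B, List.Perm.refl _, hB, rfl, rfl⟩
  | [a], _, h, _, _ => by simp at h
  | a :: b :: A, hA, hE, h1, h2 => by
    obtain ⟨B₁, p, c, hh, ht⟩ := exists_insert_list hB A hA.of_cons.of_cons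
      (by simpa [Nat.even_add_one] using hE)
      (fun x hx => h1 x (by simp [hx])) (fun x hx => h2 x (by simp [hx]))
    have hm : ∀ {P : V → Prop}, (∃ b ∈ B, P b) → ∃ b ∈ B₁, P b := by
      rintro P ⟨b, hb, hP⟩
      exact ⟨b, p.mem_iff.2 (by simp [hb]), hP⟩
    obtain ⟨B₂, p', c', hh', ht'⟩ := exists_insert_pair c hA.rel
      (hm (h1 a (by simp))) (hm (h1 b (by simp))) (hm (h2 a (by simp))) (hm (h2 b (by simp)))
    exact ⟨B₂, p'.trans (by simpa using p), c', hh'.trans hh, ht'.trans ht⟩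

/-! ### Distance levels in triangle-free graphs without an induced spider -/

/-- `G` has no triangle. -/
def NoTriangle (G : SimpleGraph V) : Prop :=
  ∀ ⦃a b c : V⦄, G.Adj a b → G.Adj b c → ¬ G.Adj a c

/-- In a triangle-free graph, this says that there is no induced spider with centre `c` and legs
`p, p'`, `s, r` and `t`. -/
def NoSpider (G : SimpleGraph V) : Prop :=
  ∀ ⦃c p p' s r t : V⦄, G.Adj c p → G.Adj p p' → G.Adj c s → G.Adj s r → G.Adj c t →
    ¬ G.Adj p r → ¬ G.Adj p' s → ¬ G.Adj p' r → ¬ G.Adj p' t → G.Adj r t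

lemma IsInducedFree.noSpider {G : SimpleGraph V} (hG : G.IsInducedFree clawTwoPendant)
    (hT : G.NoTriangle) : G.NoSpider := by
  intro c p p' s r t h1 h2 h3 h4 h5 n1 n2 n3 n4
  by_contra n5
  apply hG
  let F : Fin 6 → V := ![c, p, s, t, p', r]
  -- Five of the ten non-edges of the spider come from the absence of triangles.
  have m1 := hT h1 h2
  have m2 := hT h3 h4
  have m3 := hT h1.symm h3
  have m4 := hT h1.symm h5
  have m5 := hT h3.symm h5
  have key : ∀ i j, G.Adj (F i) (F j) ↔ clawTwoPendant.Adj i j := by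
    have aux : ∀ i j : Fin 6, i < j → (G.Adj (F i) (F j) ↔ clawTwoPendant.Adj i j) := by
      intro i j hij
      fin_cases i <;> fin_cases j <;>
        first
        | (exfalso; revert hij; decide)
        | (simp [F, clawTwoPendant, *]; done)
        | simp [F, clawTwoPendant, G.adj_comm, *]
    intro i j
    rcases lt_trichotomy i j with h | rfl | h
    · exact aux i j h
    · simp
    · rw [G.adj_comm, clawTwoPendant.adj_comm]; exact aux j i h
  have inj : Function.Injective F := by
    -- No two vertices of the spider have the same neighbourhood, so preserving adjacency both ways
    -- already forces injectivity.
    have twin : ∀ i j : Fin 6,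
        (∀ k, clawTwoPendant.Adj i k ↔ clawTwoPendant.Adj j k) → i = j := by
      simp only [clawTwoPendant, fromEdgeSet_adj, Set.mem_insert_iff, Set.mem_singleton_iff]
      decide
    intro i j hij
    exact twin i j fun k => by rw [← key, ← key, hij]
  exact ⟨⟨⟨F, inj⟩, fun {i j} => key i j⟩⟩

lemma Reachable.exists_adj_dist_eq {K : SimpleGraph V} {a v : V} {i : ℕ} (h : K.Reachable a v)
    (hd : K.dist a v = i + 1) : ∃ u, K.Reachable a u ∧ K.dist a u = i ∧ K.Adj u v := by
  obtain ⟨p, hp⟩ := h.symm.exists_walk_length_eq_dist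
  rw [dist_comm, hd] at hp
  cases p with
  | nil => simp at hp
  | @cons _ u _ hadj q =>
    have hq : q.length = i := by simpa using hp
    refine ⟨u, q.reachable.symm, ?_, hadj.symm⟩
    have h1 : K.dist a u ≤ i := by rw [dist_comm, ← hq]; exact dist_le q
    have := (hadj.diff_dist_adj (u := a))
    omega

/-- Let `s` be a neighbour of `r` one level below, and `t` a neighbour of `s` below that. By
induction `t` is also adjacent to `s'`. The legs from `t` down two levels towards `a`, up through
`s` to `r`, and to `s'` form a spider unless `r` and `s'` are adjacent. The downward leg needs `t`
on level at least 2, so levels 1 and 2 are assumed to have at most one vertex. -/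
lemma adj_of_dist_eq_add_one {K : SimpleGraph V} (hS : K.NoSpider) {a : V}
    (h1 : ∀ u v, K.Adj a u → K.Adj a v → u = v)
    (h2 : ∀ u v, K.dist a u = 2 → K.dist a v = 2 → u = v) :
    ∀ (i : ℕ) (u v : V), K.Reachable a u → K.dist a u = i → K.Reachable a v →
      K.dist a v = i + 1 → K.Adj u v := by
  intro i
  induction i with
  | zero =>
    intro u v hu hu' hv hv'
    rw [hu.dist_eq_zero_iff] at hu'
    subst hu'
    exact dist_eq_one_iff_adj.1 hv'
  | succ i ih =>
    intro s' r hs' ds' hr dr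
    obtain ⟨s, hs, ds, hsr⟩ := hr.exists_adj_dist_eq dr
    match i, ih with
    | 0, _ =>
      have := h1 s s' (dist_eq_one_iff_adj.1 ds) (dist_eq_one_iff_adj.1 ds')
      exact this ▸ hsr
    | 1, _ => exact h2 s s' ds ds' ▸ hsr
    | i + 2, ih =>
      obtain ⟨t, ht, dt, hts⟩ := hs.exists_adj_dist_eq ds
      obtain ⟨p, hp, dp, hpt⟩ := ht.exists_adj_dist_eq dt
      obtain ⟨p', hp', dp', hpp'⟩ := hp.exists_adj_dist_eq dp
      have far : ∀ {u v : V}, K.dist a u + 1 < K.dist a v → ¬ K.Adj u v := by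
        intro u v h hadj
        have := (hadj.diff_dist_adj (u := a))
        omega
      exact (hS hpt.symm hpp'.symm hts hsr (ih t s' ht dt hs' ds') (far (by omega))
        (far (by omega)) (far (by omega)) (far (by omega))).symm

lemma adj_iff_consecutiveLevels_dist {K : SimpleGraph V} (hT : K.NoTriangle) (hS : K.NoSpider)
    {a : V} (h1 : ∀ u v, K.Adj a u → K.Adj a v → u = v)
    (h2 : ∀ u v, K.dist a u = 2 → K.dist a v = 2 → u = v) {u v : V}
    (hu : K.Reachable a u) (hv : K.Reachable a v) :
    K.Adj u v ↔ ConsecutiveLevels (K.dist a) u v := by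
  constructor
  · intro hadj
    have hne : K.dist a u ≠ K.dist a v := by
      intro he
      cases hi : K.dist a u with
      | zero =>
        have hv0 := he ▸ hi
        rw [hu.dist_eq_zero_iff] at hi
        rw [hv.dist_eq_zero_iff] at hv0
        exact hadj.ne (hi.symm.trans hv0)
      | succ i =>
        -- An edge within a level makes a triangle with any vertex one level below.
        obtain ⟨t, ht, dt, htu⟩ := hu.exists_adj_dist_eq hi
        have htv := adj_of_dist_eq_add_one hS h1 h2 i t v ht dt hv (he ▸ hi)
        exact hT htu hadj htv
    have := hadj.diff_dist_adj (u := a)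
    unfold ConsecutiveLevels
    omega
  · rintro (h | h)
    · exact (adj_of_dist_eq_add_one hS h1 h2 _ v u hv rfl hu h).symm
    · exact adj_of_dist_eq_add_one hS h1 h2 _ u v hu rfl hv h

/-! ### Rerouting a longest cycle -/

/-- The number of ordered pairs of adjacent vertices that both avoid the list `l`. -/
noncomputable def offPairs (G : SimpleGraph V) (l : List V) : ℕ :=
  {p : V × V | G.Adj p.1 p.2 ∧ p.1 ∉ l ∧ p.2 ∉ l}.ncard

/-- `P` is a path with all vertices in `H` that joins a neighbour of `x` to a neighbour of `y`. -/
structure IsDetour (G : SimpleGraph V) (H : Set V) (x y : V) (P : List V) : Prop where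
  ne_nil : P ≠ []
  nodup : P.Nodup
  isChain : P.IsChain G.Adj
  mem : ∀ p ∈ P, p ∈ H
  adj_head : ∀ p ∈ P.head?, G.Adj x p
  adj_last : ∀ p ∈ P.getLast?, G.Adj p y

/-- The cycle `x :: R` is longest and, among the longest cycles, leaves the fewest edges
uncovered; `H` lies off the cycle, and the vertices of `D`, which do not touch `H`, are arranged
in levels by `f` such that adjacency in `D` means being in consecutive levels. -/
structure IsLeveledCycle (G : SimpleGraph V) (x : V) (R : List V) (H D : Set V) (f : V → ℕ) :
    Prop where
  isListCycle : G.IsListCycle x R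
  longest : ∀ x' R', G.IsListCycle x' R' → R'.length ≤ R.length
  offPairs_le : ∀ x' R', G.IsListCycle x' R' → R'.length = R.length →
    G.offPairs (x :: R) ≤ G.offPairs (x' :: R')
  notMem_of_mem : ∀ h ∈ H, h ∉ x :: R
  exists_adj : ∀ h ∈ H, ∃ h' ∈ H, G.Adj h h'
  notMem_of_mem_level : ∀ u ∈ D, u ∉ H
  not_adj : ∀ u ∈ D, ∀ h ∈ H, ¬ G.Adj u h
  mem_level_of_adj : ∀ u ∈ D, ∀ v, v ∉ x :: R → G.Adj u v → v ∈ D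
  adj_iff : ∀ u ∈ D, ∀ v ∈ D, G.Adj u v ↔ ConsecutiveLevels f u v
  le_of_adj : ∀ u ∈ D, G.Adj x u → ∀ v ∈ D, f u ≤ f v

lemma IsLeveledCycle.reverse {G : SimpleGraph V} {x : V} {R : List V} {H D : Set V} {f : V → ℕ}
    (h : G.IsLeveledCycle x R H D f) : G.IsLeveledCycle x R.reverse H D f := by
  obtain ⟨h1, h2, h3, h4, h5, h6, h7, h8, h9, h10⟩ := h
  refine ⟨h1.reverse, by simpa using h2, ?_, by simpa using h4, h5, h6, h7,
    by simpa using h8, h9, h10⟩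
  have : G.offPairs (x :: R.reverse) = G.offPairs (x :: R) := by simp [offPairs]
  rw [this]
  simpa using h3

lemma isChain_consecutiveLevels {G : SimpleGraph V} {D : Set V} {f : V → ℕ}
    (hD : ∀ u ∈ D, ∀ v ∈ D, G.Adj u v ↔ ConsecutiveLevels f u v) {l : List V}
    (hl : ∀ a ∈ l, a ∈ D) : l.IsChain (ConsecutiveLevels f) ↔ l.IsChain G.Adj := by
  induction l with
  | nil => simp
  | cons a l ih =>
    cases l with
    | nil => simp
    | cons b l =>
      rw [List.isChain_cons_cons, List.isChain_cons_cons, ih fun c hc => hl c (by simp [hc]),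
        hD a (hl a (by simp)) b (hl b (by simp))]

/-- The detour `P` replaces `A`, and `A'` is absorbed into `B`. The list `A'` is left free because,
depending on parity, it will be `A`, `A` without its last vertex, or `A` with one more vertex. -/
lemma IsLeveledCycle.exists_reroute {G : SimpleGraph V} {x y : V} {A M B P A' : List V}
    {H D : Set V} {f : V → ℕ} (h : G.IsLeveledCycle x (A ++ (y :: M) ++ B) H D f)
    (hB : ∀ b ∈ B, b ∈ D) (hP : G.IsDetour H x y P) (hA' : A'.IsChain G.Adj)
    (hA'n : A'.Nodup) (hA'D : ∀ a ∈ A', a ∈ D) (hE : Even A'.length)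
    (hdis : ∀ a ∈ A', a ∉ x :: (y :: M ++ B)) (hle : ∀ a ∈ A', ∃ b ∈ B, f a ≤ f b) :
    ∃ B', B'.Perm (A' ++ B) ∧ G.IsListCycle x (P ++ (y :: M) ++ B') := by
  obtain ⟨hn, -, hc⟩ := h.isListCycle
  have e : x :: (A ++ (y :: M) ++ B ++ [x]) = (x :: A) ++ ((y :: M) ++ (B ++ [x])) := by simp
  rw [e] at hc
  have hc2 := hc.right_of_append
  rw [List.isChain_append] at hc2
  obtain ⟨hM, hBx, hMB⟩ := hc2
  rw [List.isChain_append] at hBx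
  obtain ⟨hBc, -, hBl⟩ := hBx
  obtain ⟨B', p, c, hh, hl⟩ := exists_insert_list
    ((isChain_consecutiveLevels h.adj_iff hB).2 hBc) A'
    ((isChain_consecutiveLevels h.adj_iff hA'D).2 hA') hE hle (by
      intro a ha
      obtain ⟨b, hb, -⟩ := hle a ha
      have hne : B ≠ [] := List.ne_nil_of_mem hb
      -- The last vertex of `B` precedes `x` on the cycle, so it lies on the lowest level of `D`.
      refine ⟨B.getLast hne, List.getLast_mem hne, ?_⟩
      refine h.le_of_adj _ (hB _ (List.getLast_mem hne)) ?_ _ (hA'D a ha)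
      exact (hBl _ (List.getLast_mem_getLast? hne) x (by simp)).symm)
  have hB'D : ∀ b ∈ B', b ∈ D := by
    intro b hb
    rcases List.mem_append.1 (p.mem_iff.1 hb) with h' | h'
    exacts [hA'D b h', hB b h']
  rw [isChain_consecutiveLevels h.adj_iff hB'D] at c
  refine ⟨B', p, ?_, ?_, ?_⟩
  · have hperm : (x :: (P ++ (y :: M) ++ B')).Perm (P ++ (A' ++ (x :: (y :: M ++ B)))) := by
      have q1 : (x :: (P ++ (y :: M) ++ B')).Perm (x :: (P ++ (y :: M) ++ (A' ++ B))) :=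
        (p.append_left _).cons _
      refine q1.trans ?_
      rw [← Multiset.coe_eq_coe]
      simp only [← Multiset.cons_coe, ← Multiset.coe_add, ← Multiset.singleton_add]
      abel
    rw [hperm.nodup_iff]
    have hR : (x :: (y :: M ++ B)).Nodup := by
      refine hn.sublist ?_
      refine List.Sublist.cons_cons _ ?_
      rw [List.append_assoc]
      exact List.sublist_append_right _ _
    rw [List.nodup_append', List.nodup_append']
    refine ⟨hP.nodup, ⟨hA'n, hR, fun a ha => hdis a ha⟩, ?_⟩
    intro a ha hb
    rcases List.mem_append.1 hb with hb | hb
    · exact h.notMem_of_mem_level a (hA'D a hb) (hP.mem a ha)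
    · refine h.notMem_of_mem a (hP.mem a ha) ?_
      simp only [List.mem_cons, List.mem_append] at hb ⊢
      tauto
  · have := List.length_pos_iff.2 hP.ne_nil
    simp; omega
  · have e : x :: (P ++ (y :: M) ++ B' ++ [x]) = x :: (P ++ ((y :: M) ++ (B' ++ [x]))) := by simp
    rw [e, List.isChain_cons, List.isChain_append, List.isChain_append, List.isChain_append]
    refine ⟨?_, hP.isChain, ⟨hM, ⟨c, by simp, by rwa [hl]⟩, ?_⟩, ?_⟩
    · rw [List.head?_append_of_ne_nil _ hP.ne_nil]
      exact hP.adj_head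
    · have : (B' ++ [x]).head? = (B ++ [x]).head? := by simp [List.head?_append, hh]
      rwa [this]
    · intro a ha b hb
      simp at hb
      subst hb
      exact hP.adj_last a ha

/-- If `A` has even length, all of it is absorbed and the cycle grows by the detour. If the length
is odd, the last vertex `a` of `A` is dropped; the cycle still grows unless the detour is a single
vertex, and then the levels of `B` reach strictly above `A`. -/
lemma IsLeveledCycle.absurd_of_levels_le [Finite V] {G : SimpleGraph V} {x y : V}
    {A M B P : List V} {H D : Set V} {f : V → ℕ}
    (h : G.IsLeveledCycle x (A ++ (y :: M) ++ B) H D f)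
    (hA : ∀ a ∈ A, a ∈ D) (hB : ∀ b ∈ B, b ∈ D) (hP : G.IsDetour H x y P)
    (hle : ∀ a ∈ A, ∃ b ∈ B, f a ≤ f b)
    (hstrict : 2 ≤ P.length ∨ ∀ a ∈ A, ∃ b ∈ B, f a < f b) : False := by
  obtain ⟨hn, -, hc⟩ := h.isListCycle
  have hPl := List.length_pos_iff.2 hP.ne_nil
  have hAc : A.IsChain G.Adj := by
    have e : x :: (A ++ (y :: M) ++ B ++ [x]) = [x] ++ (A ++ ((y :: M) ++ (B ++ [x]))) := by simp
    rw [e] at hc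
    exact hc.right_of_append.left_of_append
  have hn2 : (A ++ (x :: (y :: M ++ B))).Nodup := by
    refine (List.Perm.nodup_iff ?_).1 hn
    have := (List.perm_middle (a := x) (l₁ := A) (l₂ := y :: M ++ B)).symm
    simpa using this
  rw [List.nodup_append'] at hn2
  obtain ⟨hAn, -, hAd⟩ := hn2
  rcases Nat.even_or_odd A.length with hE | hO
  · obtain ⟨B', p, hC'⟩ := h.exists_reroute hB hP hAc hAn hA hE (fun a ha => hAd ha) hle
    have h1 := h.longest _ _ hC'
    have h2 := p.length_eq
    simp at h1 h2
    omega
  have hne : A ≠ [] := by rintro rfl; simp at hO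
  have hsplit := List.dropLast_append_getLast hne
  have hlen : A.dropLast.length + 1 = A.length := by
    have := List.length_pos_iff.2 hne
    rw [List.length_dropLast]; omega
  set a := A.getLast hne with ha
  have haA : a ∈ A := List.getLast_mem hne
  have hsub : ∀ b ∈ A.dropLast, b ∈ A := fun b hb => List.mem_of_mem_dropLast hb
  obtain ⟨B', p, hC'⟩ := h.exists_reroute (A' := A.dropLast) hB hP
    (by rw [← hsplit] at hAc; exact hAc.left_of_append)
    (hAn.sublist (List.dropLast_sublist A)) (fun b hb => hA b (hsub b hb))
    (by rw [← hlen] at hO; rw [← Nat.not_odd_iff_even]; intro h'; exact (by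
          rw [Nat.odd_add_one] at hO; exact hO h'))
    (fun b hb => hAd (hsub b hb)) (fun b hb => hle b (hsub b hb))
  have h1 := h.longest _ _ hC'
  have h2 := p.length_eq
  have hP1 : P.length = 1 := by
    simp at h1 h2 hlen
    omega
  replace hstrict := hstrict.resolve_left (by omega)
  -- An uncovered neighbour `v` of `a` repairs the parity: `A ++ [v]` is absorbed whole. Without
  -- one, dropping `a` uncovers no edge.
  by_cases hv : ∃ v, v ∉ x :: (A ++ (y :: M) ++ B) ∧ G.Adj a v
  · obtain ⟨v, hv1, hv2⟩ := hv
    have hvD := h.mem_level_of_adj a (hA a haA) v hv1 hv2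
    obtain ⟨B', p, hC'⟩ := h.exists_reroute (A' := A ++ [v]) hB hP
      (by
        rw [List.isChain_append]
        refine ⟨hAc, by simp, ?_⟩
        intro b hb c hc
        rw [List.getLast?_eq_some_getLast hne] at hb
        simp at hb hc
        rw [← hb, ← hc]
        exact hv2)
      (by
        rw [List.nodup_append']
        refine ⟨hAn, by simp, ?_⟩
        intro b hb hb'
        simp at hb'
        subst hb'
        exact hv1 (by simp [hb]))
      (by
        intro b hb
        rcases List.mem_append.1 hb with hb | hb
        · exact hA b hb
        · simp at hb; exact hb ▸ hvD)
      (by simpa using hO.add_one)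
      (by
        intro b hb
        rcases List.mem_append.1 hb with hb | hb
        · exact hAd hb
        · simp at hb
          subst hb
          intro h'
          apply hv1
          simp only [List.mem_cons, List.mem_append] at h' ⊢
          tauto)
      (by
        intro b hb
        rcases List.mem_append.1 hb with hb | hb
        · exact hle b hb
        · simp at hb
          subst hb
          -- The level of `v` exceeds that of `a` by at most one, which the strict inequality
          -- allows.
          obtain ⟨c, hc, hac⟩ := hstrict a haA
          have := (h.adj_iff a (hA a haA) b hvD).1 hv2
          unfold ConsecutiveLevels at this
          exact ⟨c, hc, by omega⟩)
    have h1 := h.longest _ _ hC'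
    have h2 := p.length_eq
    simp at h1 h2
    omega
  · push Not at hv
    have h3 := h.offPairs_le _ _ hC' (by simp at h1 h2 hlen ⊢; omega)
    refine absurd h3 (not_le.2 (Set.ncard_lt_ncard ?_ (Set.toFinite _)))
    obtain ⟨w, hw⟩ := List.exists_mem_of_ne_nil _ hP.ne_nil
    obtain ⟨w', hw', hww'⟩ := h.exists_adj w (hP.mem w hw)
    have key : ∀ u, u ∉ x :: (P ++ (y :: M) ++ B') →
        u = a ∨ u ∉ x :: (A ++ (y :: M) ++ B) := by
      intro u hu
      by_contra! hcon
      obtain ⟨hua, hu'⟩ := hcon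
      apply hu
      have hu2 : u ∈ A → u ∈ A.dropLast := by
        intro h'
        rw [← hsplit] at h'
        simpa [hua] using h'
      simp only [List.mem_cons, List.mem_append, p.mem_iff] at hu' ⊢
      tauto
    constructor
    · rintro ⟨s, t⟩ ⟨hst, hs, ht⟩
      dsimp only at hst hs ht
      rcases key s hs with rfl | hs'
      · rcases key t ht with h' | ht'
        · exact absurd (h' ▸ hst) (G.loopless.irrefl _)
        · exact absurd hst (hv t ht')
      · rcases key t ht with rfl | ht'
        · exact absurd hst.symm (hv s hs')
        · exact ⟨hst, hs', ht'⟩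
    -- The detour vertex `w` has a neighbour `w'` in `H`; this edge was uncovered and now is
    -- covered.
    · intro hss
      have := hss (show (w, w') ∈ _ from
        ⟨hww', h.notMem_of_mem w (hP.mem w hw), h.notMem_of_mem w' hw'⟩)
      exact this.2.1 (by simp [hw])

/-! ### Triangle-free graphs -/

/-- No vertex other than `v` separates: every nontrivial vertex set has an edge leaving it that
avoids `v`. -/
def HasCrossingEdges (G : SimpleGraph V) : Prop :=
  ∀ (v : V) (S : Set V), (∃ s ∈ S, s ≠ v) → (∃ t, t ∉ S ∧ t ≠ v) →
    ∃ a ∈ S, ∃ b, b ∉ S ∧ a ≠ v ∧ b ≠ v ∧ G.Adj a b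

lemma IsKConnected.hasCrossingEdges [Fintype V] {G : SimpleGraph V} (h : G.IsKConnected 2) :
    G.HasCrossingEdges := by
  rintro v S ⟨s, hs, hsv⟩ ⟨t, ht, htv⟩
  have hc := h.2 {v} (by simp)
  obtain ⟨p⟩ := hc.preconnected ⟨s, by simpa using hsv⟩ ⟨t, by simpa using htv⟩
  obtain ⟨d, -, hd1, hd2⟩ := p.exists_boundary_dart {z | z.1 ∈ S} hs ht
  exact ⟨d.fst.1, hd1, d.snd.1, hd2, by simpa using d.fst.2, by simpa using d.snd.2, d.adj⟩

/-- Levels are distances from `w'` in the graph `K` that keeps, besides `w'`, `w` and `x`, only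
vertices outside `H` without neighbours in `H`. There `w'` has only the neighbour `w`, and `w` only
`w'` and `x`, so levels 1 and 2 are single vertices. -/
lemma exists_isLeveledCycle {G : SimpleGraph V} (hT : G.NoTriangle) (hS : G.NoSpider)
    {x : V} {R : List V} {H : Set V} (hC : G.IsListCycle x R)
    (hlong : ∀ x' R', G.IsListCycle x' R' → R'.length ≤ R.length)
    (hoff : ∀ x' R', G.IsListCycle x' R' → R'.length = R.length →
      G.offPairs (x :: R) ≤ G.offPairs (x' :: R'))
    (hH : ∀ h ∈ H, h ∉ x :: R) (hHc : ∀ h ∈ H, ∀ u, G.Adj h u → u ∈ H ∨ u ∈ x :: R)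
    (hHa : ∀ h ∈ H, ∃ h' ∈ H, G.Adj h h') {w : V} (hw : w ∈ H) (hxw : G.Adj x w) :
    ∃ (D : Set V) (f : V → ℕ), G.IsLeveledCycle x R H D f ∧
      ∀ l : List V, l.IsChain G.Adj → (∀ a ∈ l.head?, G.Adj x a) →
        (∀ a ∈ l, a ∉ H ∧ ∀ h ∈ H, ¬ G.Adj a h) → ∀ a ∈ l, a ∈ D := by
  obtain ⟨w', hw', hww'⟩ := hHa w hw
  let G₀ : Set V := {u | u ∉ H ∧ ∀ h ∈ H, ¬ G.Adj u h}
  let W : Set V := {u | u = w' ∨ u = w ∨ u = x ∨ u ∈ G₀}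
  let K : SimpleGraph V :=
    { Adj := fun u v => G.Adj u v ∧ u ∈ W ∧ v ∈ W
      symm := ⟨fun u v h => ⟨h.1.symm, h.2.2, h.2.1⟩⟩
      loopless := ⟨fun u h => h.1.ne rfl⟩ }
  have hwW : w ∈ W := Or.inr (Or.inl rfl)
  have hwW' : w' ∈ W := Or.inl rfl
  have hxW : x ∈ W := Or.inr (Or.inr (Or.inl rfl))
  have hKT : K.NoTriangle := fun a b c h1 h2 h3 => hT h1.1 h2.1 h3.1
  have hKS : K.NoSpider := by
    intro c p p' s r t h1 h2 h3 h4 h5 n1 n2 n3 n4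
    have lift : ∀ {u v}, u ∈ W → v ∈ W → ¬ K.Adj u v → ¬ G.Adj u v :=
      fun hu hv h h' => h ⟨h', hu, hv⟩
    exact ⟨hS h1.1 h2.1 h3.1 h4.1 h5.1 (lift h2.2.1 h4.2.2 n1) (lift h2.2.2 h3.2.2 n2)
      (lift h2.2.2 h4.2.2 n3) (lift h2.2.2 h5.2.2 n4), h4.2.2, h5.2.2⟩
  have hN : ∀ u, K.Adj w' u → u = w := by
    rintro u ⟨h1, -, rfl | rfl | rfl | h2⟩
    · exact absurd rfl h1.ne
    · rfl
    · exact absurd h1 (hT hww'.symm hxw.symm)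
    · exact absurd h1.symm (h2.2 _ hw')
  have hN2 : ∀ u, K.dist w' u = 2 → u = x := by
    intro u hu
    have hr : K.Reachable w' u := Reachable.of_dist_ne_zero (by omega)
    obtain ⟨t, ht, dt, htu⟩ := hr.exists_adj_dist_eq hu
    obtain rfl := hN t (dist_eq_one_iff_adj.1 dt)
    obtain ⟨h1, -, rfl | rfl | rfl | h2⟩ := htu
    · simp at hu
    · exact absurd rfl h1.ne
    · rfl
    · exact absurd h1.symm (h2.2 _ hw)
  have hKw : K.Adj w' w := ⟨hww'.symm, hwW', hwW⟩
  have hKx : K.Adj w x := ⟨hxw.symm, hwW, hxW⟩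
  let D : Set V := {u | u ∈ G₀ ∧ K.Reachable w' u}
  have hstep : ∀ u ∈ D, ∀ v ∈ G₀, G.Adj u v → v ∈ D := fun u hu v hv huv =>
    ⟨hv, hu.2.trans (Adj.reachable (G := K)
      ⟨huv, Or.inr (Or.inr (Or.inr hu.1)), Or.inr (Or.inr (Or.inr hv))⟩)⟩
  have hfirst : ∀ v ∈ G₀, G.Adj x v → v ∈ D := fun v hv hxv =>
    ⟨hv, hKw.reachable.trans (hKx.reachable.trans (Adj.reachable (G := K)
      ⟨hxv, hxW, Or.inr (Or.inr (Or.inr hv))⟩))⟩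
  refine ⟨D, K.dist w', ⟨hC, hlong, hoff, hH, hHa, fun u hu => hu.1.1, fun u hu => hu.1.2,
    ?_, ?_, ?_⟩, ?_⟩
  · intro u hu v hv huv
    have hvH : v ∉ H := fun h => hu.1.2 v h huv
    refine hstep u hu v ⟨hvH, fun h hh hvh => ?_⟩ huv
    exact (hHc h hh v hvh.symm).elim hvH hv
  · intro u hu v hv
    rw [← adj_iff_consecutiveLevels_dist hKT hKS (fun u v hu hv => (hN u hu).trans (hN v hv).symm)
      (fun u v hu hv => (hN2 u hu).trans (hN2 v hv).symm) hu.2 hv.2]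
    exact ⟨fun h => ⟨h, Or.inr (Or.inr (Or.inr hu.1)), Or.inr (Or.inr (Or.inr hv.1))⟩,
      fun h => h.1⟩
  · intro u hu hxu v hv
    -- Levels 0, 1 and 2 are taken by `w'`, `w` and `x`, so `D` starts at level 3, where its
    -- neighbours of `x` lie.
    have hKu : K.Adj x u := ⟨hxu, hxW, Or.inr (Or.inr (Or.inr hu.1))⟩
    have h3 : K.dist w' u ≤ 3 := dist_le (.cons hKw (.cons hKx (.cons hKu .nil)))
    have h0 : K.dist w' v ≠ 0 := by
      rw [Ne, hv.2.dist_eq_zero_iff]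
      rintro rfl
      exact hv.1.1 hw'
    have h1 : K.dist w' v ≠ 1 := by
      rw [Ne, dist_eq_one_iff_adj]
      intro h
      exact hv.1.1 (hN v h ▸ hw)
    have h2 : K.dist w' v ≠ 2 := fun h => hv.1.2 w hw (hN2 v h ▸ hxw)
    omega
  · have aux : ∀ l : List V, l.IsChain G.Adj → (∀ a ∈ l.head?, a ∈ D) →
        (∀ a ∈ l, a ∈ G₀) → ∀ a ∈ l, a ∈ D := by
      intro l
      induction l with
      | nil => simp
      | cons b l ih =>
        intro hc hh hG a ha
        have hb : b ∈ D := hh b (by simp)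
        rcases List.mem_cons.1 ha with rfl | ha
        · exact hb
        · refine ih hc.of_cons ?_ (fun a ha => hG a (by simp [ha])) a ha
          intro c hcl
          exact hstep b hb c (hG c (by simp [List.mem_of_mem_head? hcl]))
            ((List.isChain_cons.1 hc).1 c hcl)
    intro l hc hh hG
    exact aux l hc (fun a ha => hfirst a (hG a (List.mem_of_mem_head? ha)) (hh a ha)) hG

/-! ### Attachments of an uncovered component to the cycle -/

lemma exists_last_split {p : V → Prop} : ∀ l : List V, (∃ a ∈ l, p a) →
    ∃ l₁ z l₂, l = l₁ ++ z :: l₂ ∧ p z ∧ ∀ b ∈ l₂, ¬ p b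
  | [], h => by simp at h
  | a :: l, h => by
    by_cases hl : ∃ b ∈ l, p b
    · obtain ⟨l₁, z, l₂, rfl, h1, h2⟩ := exists_last_split l hl
      exact ⟨a :: l₁, z, l₂, rfl, h1, h2⟩
    · obtain ⟨b, hb, hpb⟩ := h
      rcases List.mem_cons.1 hb with rfl | hb
      · exact ⟨[], b, l, rfl, hpb, fun c hc hpc => hl ⟨c, hc, hpc⟩⟩
      · exact absurd ⟨b, hb, hpb⟩ hl

lemma IsListCycle.exists_rotate {G : SimpleGraph V} {x y : V} {R : List V}
    (h : G.IsListCycle x R) (hy : y ∈ x :: R) :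
    ∃ R', G.IsListCycle y R' ∧ (y :: R').Perm (x :: R) := by
  rcases List.mem_cons.1 hy with rfl | hy
  · exact ⟨R, h, List.Perm.refl _⟩
  · obtain ⟨A, B, rfl⟩ := List.append_of_mem hy
    refine ⟨_, h.rotate, ?_⟩
    have := List.perm_append_comm (l₁ := y :: B) (l₂ := x :: A)
    simpa using this

/-- The cycle `x :: (A ++ y :: M)` runs through the vertices of `L`, and `x` and `y` have distinct
neighbours in `H`. -/
def HasDistinctAttachments (G : SimpleGraph V) (H : Set V) (L : List V) (x : V) (A : List V)
    (y : V) (M : List V) : Prop :=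
  G.IsListCycle x (A ++ y :: M) ∧ (x :: (A ++ y :: M)).Perm L ∧
    ∃ a ∈ H, ∃ b ∈ H, a ≠ b ∧ G.Adj x a ∧ G.Adj y b

/-- Two edges leave `H` with different ends on the cycle. If they share their end `a` in `H`, an
edge leaving `H` that avoids `a` can replace one of them. -/
lemma exists_hasDistinctAttachments {G : SimpleGraph V} (hG : G.HasCrossingEdges) {x₀ : V}
    {R₀ : List V} {H : Set V} (hC : G.IsListCycle x₀ R₀) (hH : ∀ h ∈ H, h ∉ x₀ :: R₀)
    (hHc : ∀ h ∈ H, ∀ u, G.Adj h u → u ∈ H ∨ u ∈ x₀ :: R₀)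
    (hHa : ∀ h ∈ H, ∃ h' ∈ H, G.Adj h h') (hne : H.Nonempty) :
    ∃ x A y M, G.HasDistinctAttachments H (x₀ :: R₀) x A y M := by
  have key : ∃ x ∈ x₀ :: R₀, ∃ y ∈ x₀ :: R₀, x ≠ y ∧
      ∃ a ∈ H, ∃ b ∈ H, a ≠ b ∧ G.Adj x a ∧ G.Adj y b := by
    obtain ⟨h, hh⟩ := hne
    obtain ⟨c, R₁, rfl⟩ : ∃ c R₁, R₀ = c :: R₁ := by
      cases R₀ with
      | nil => simp [IsListCycle] at hC
      | cons c R₁ => exact ⟨c, R₁, rfl⟩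
    have hx₀ : x₀ ∉ H := fun h' => hH _ h' (by simp)
    have hc : c ∉ H := fun h' => hH _ h' (by simp)
    have hcx : c ≠ x₀ := by rintro rfl; simpa using hC.1
    obtain ⟨a, ha, x, hx, -, -, hax⟩ := hG x₀ H ⟨h, hh, fun e => hx₀ (e ▸ hh)⟩ ⟨c, hc, hcx⟩
    have hxC := (hHc a ha x hax).resolve_left hx
    obtain ⟨b, hb, y, hy, -, hyx, hby⟩ := hG x H ⟨h, hh, fun e => hx (e ▸ hh)⟩ (by
      by_cases h' : c = x
      · exact ⟨x₀, hx₀, fun e => hcx (h'.trans e.symm)⟩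
      · exact ⟨c, hc, h'⟩)
    have hyC := (hHc b hb y hby).resolve_left hy
    by_cases hab : a = b
    · subst hab
      obtain ⟨a', ha', haa'⟩ := hHa a ha
      obtain ⟨d, hd, u, hu, hda, -, hdu⟩ := hG a H ⟨a', ha', haa'.ne'⟩
        ⟨x, hx, fun e => hx (e ▸ ha)⟩
      have huC := (hHc d hd u hdu).resolve_left hu
      by_cases hux : u = x
      · subst hux
        exact ⟨y, hyC, u, hxC, hyx, a, ha, d, hd, hda.symm, hby.symm, hdu.symm⟩
      · exact ⟨x, hxC, u, huC, Ne.symm hux, a, ha, d, hd, hda.symm, hax.symm, hdu.symm⟩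
    · exact ⟨x, hxC, y, hyC, hyx.symm, a, ha, b, hb, hab, hax.symm, hby.symm⟩
  obtain ⟨x, hx, y, hy, hxy, hab⟩ := key
  obtain ⟨R, hR, p⟩ := hC.exists_rotate hx
  have hyR : y ∈ R := by
    have := p.mem_iff.2 hy
    simpa [hxy.symm] using this
  obtain ⟨A, M, rfl⟩ := List.append_of_mem hyR
  exact ⟨x, A, y, M, hR, p, hab⟩

/-- Take `A` shortest. A neighbour `c` in `H` of an inner vertex `u` differs from `a` or from `b`,
so `u` could replace `y` or `x`. -/
lemma exists_minimal_attachments {G : SimpleGraph V} {H : Set V} {L : List V}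
    (h : ∃ x A y M, G.HasDistinctAttachments H L x A y M) :
    ∃ x A y M, G.HasDistinctAttachments H L x A y M ∧ ∀ u ∈ A, ∀ h ∈ H, ¬ G.Adj u h := by
  classical
  have hex : ∃ n, ∃ x A y M, G.HasDistinctAttachments H L x A y M ∧ A.length = n := by
    obtain ⟨x, A, y, M, h⟩ := h
    exact ⟨_, x, A, y, M, h, rfl⟩
  obtain ⟨x, A, y, M, ⟨hC, p, a, ha, b, hb, hab, hxa, hyb⟩, hn⟩ := Nat.find_spec hex
  refine ⟨x, A, y, M, ⟨hC, p, a, ha, b, hb, hab, hxa, hyb⟩, ?_⟩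
  intro u hu c hc huc
  obtain ⟨A₁, A₂, rfl⟩ := List.append_of_mem hu
  simp only [List.length_append, List.length_cons] at hn
  by_cases hac : a = c
  · subst hac
    have e : (A₁ ++ u :: A₂) ++ y :: M = A₁ ++ u :: (A₂ ++ y :: M) := by simp
    rw [e] at hC p
    have e' : (A₂ ++ y :: M) ++ x :: A₁ = A₂ ++ y :: (M ++ x :: A₁) := by simp
    refine Nat.find_min hex (m := A₂.length) (by omega)
      ⟨u, A₂, y, M ++ x :: A₁, ⟨e' ▸ hC.rotate, ?_, a, ha, b, hb, hab, huc, hyb⟩, rfl⟩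
    refine List.Perm.trans ?_ p
    have := List.perm_append_comm (l₁ := u :: (A₂ ++ y :: M)) (l₂ := x :: A₁)
    simpa using this
  · exact Nat.find_min hex (m := A₁.length) (by omega)
      ⟨x, A₁, u, A₂ ++ y :: M, ⟨by simpa using hC, by simpa using p, a, ha, c, hc, hac, hxa, huc⟩,
        rfl⟩

lemma offPairs_congr {G : SimpleGraph V} {l l' : List V} (h : l.Perm l') :
    G.offPairs l = G.offPairs l' := by
  simp [offPairs, h.mem_iff]

/-- A longest cycle of a triangle-free graph without induced spiders and cut vertices, which leaves
as few edges as possible uncovered, leaves no connected set with an edge uncovered. -/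
lemma absurd_of_uncovered_set [Finite V] {G : SimpleGraph V} (hG : G.HasCrossingEdges)
    (hT : G.NoTriangle) (hS : G.NoSpider) {x₀ : V} {R₀ : List V} {H : Set V}
    (hC : G.IsListCycle x₀ R₀)
    (hlong : ∀ x' R', G.IsListCycle x' R' → R'.length ≤ R₀.length)
    (hoff : ∀ x' R', G.IsListCycle x' R' → R'.length = R₀.length →
      G.offPairs (x₀ :: R₀) ≤ G.offPairs (x' :: R'))
    (hH : ∀ h ∈ H, h ∉ x₀ :: R₀) (hHc : ∀ h ∈ H, ∀ u, G.Adj h u → u ∈ H ∨ u ∈ x₀ :: R₀)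
    (hHa : ∀ h ∈ H, ∃ h' ∈ H, G.Adj h h') (hne : H.Nonempty)
    (hHp : ∀ a ∈ H, ∀ b ∈ H, ∃ P : List V, P ≠ [] ∧ P.Nodup ∧ P.IsChain G.Adj ∧
      (∀ p ∈ P, p ∈ H) ∧ P.head? = some a ∧ P.getLast? = some b) : False := by
  obtain ⟨x, A, y, M₀, ⟨hC', p, a, ha, b, hb, hab, hxa, hyb⟩, hA⟩ :=
    exists_minimal_attachments (exists_hasDistinctAttachments hG hC hH hHc hHa hne)
  have detour : ∀ {u c d}, c ∈ H → d ∈ H → G.Adj x c → G.Adj u d →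
      ∃ P, G.IsDetour H x u P ∧ (c ≠ d → 2 ≤ P.length) := by
    intro u c d hc hd hxc hud
    obtain ⟨P, h1, h2, h3, h4, h5, h6⟩ := hHp c hc d hd
    refine ⟨P, ⟨h1, h2, h3, h4, ?_, ?_⟩, fun hcd => ?_⟩
    · rw [h5]; simpa using hxc
    · rw [h6]; simpa using hud.symm
    · match P, h1, h5, h6 with
      | [q], _, h5, h6 => simp at h5 h6; exact absurd (h5.symm.trans h6) hcd
      | _ :: _ :: _, _, _, _ => simp
  -- Possibly `z = y`; then the kept segment `y :: M` is a single vertex.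
  obtain ⟨l₁, z, B, hM, ⟨d, hd, hzd⟩, hB⟩ := exists_last_split (p := fun u => ∃ h ∈ H, G.Adj u h)
    (y :: M₀) ⟨y, by simp, b, hb, hyb⟩
  obtain ⟨M, hM'⟩ : ∃ M, l₁ ++ [z] = y :: M := by
    cases l₁ with
    | nil => simp at hM; exact ⟨[], by simp [hM.1]⟩
    | cons c l₁ => simp at hM; exact ⟨l₁ ++ [z], by simp [hM.1]⟩
  have hR : A ++ y :: M₀ = A ++ (y :: M) ++ B := by
    rw [hM, ← hM']; simp
  have hRr : (A ++ (y :: M) ++ B).reverse = B.reverse ++ (z :: l₁.reverse) ++ A.reverse := by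
    rw [← hM']; simp
  rw [hR] at hC' p
  have hlen : (A ++ (y :: M) ++ B).length = R₀.length := by
    have := p.length_eq
    simpa only [List.length_cons, Nat.add_right_cancel_iff] using this
  have hmem : ∀ {u}, u ∈ x :: (A ++ (y :: M) ++ B) ↔ u ∈ x₀ :: R₀ := p.mem_iff
  obtain ⟨D, f, hL, hD⟩ := exists_isLeveledCycle (H := H) hT hS hC'
    (by rwa [hlen]) (by rwa [hlen, offPairs_congr p])
    (fun h hh => by rw [hmem]; exact hH h hh)
    (fun h hh u => by rw [hmem]; exact hHc h hh u) hHa ha hxa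
  have hnotH : ∀ u ∈ x :: (A ++ (y :: M) ++ B), u ∉ H := fun u hu huH =>
    hH u huH (hmem.1 hu)
  have hinit : ∀ A' M' B' : List V, G.IsListCycle x (A' ++ M' ++ B') →
      A'.IsChain G.Adj ∧ ∀ c ∈ A'.head?, G.Adj x c := by
    intro A' M' B' h
    have h3 := h.2.2
    have e : x :: (A' ++ M' ++ B' ++ [x]) = (x :: A') ++ (M' ++ B' ++ [x]) := by simp
    rw [e] at h3
    have := List.isChain_cons.1 h3.left_of_append
    exact ⟨this.2, this.1⟩
  have hAD : ∀ c ∈ A, c ∈ D := by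
    obtain ⟨h1, h2⟩ := hinit _ _ _ hC'
    exact hD A h1 h2 fun c hc => ⟨hnotH c (by simp [hc]), hA c hc⟩
  have hBD : ∀ c ∈ B, c ∈ D := by
    have := hC'.reverse
    rw [hRr] at this
    obtain ⟨h1, h2⟩ := hinit _ _ _ this
    intro c hc
    exact hD B.reverse h1 h2 (fun c hc => ⟨hnotH c (by simp at hc; simp [hc]),
      fun h hh hch => hB c (by simpa using hc) ⟨h, hh, hch⟩⟩) c (by simpa using hc)
  -- Either `B` absorbs `A`, with a detour of at least two vertices since `a ≠ b`, or on the
  -- reversed cycle `A` absorbs `B`. In the latter case the detour from `x` to `z` may be a single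
  -- vertex, but `A` reaches strictly higher.
  by_cases hle : ∀ c ∈ A, ∃ e ∈ B, f c ≤ f e
  · obtain ⟨P, hP, hP2⟩ := detour ha hb hxa hyb
    exact hL.absurd_of_levels_le hAD hBD hP hle (Or.inl (hP2 hab))
  · push Not at hle
    obtain ⟨c, hc, hlt⟩ := hle
    obtain ⟨P, hP, -⟩ := detour ha hd hxa hzd
    have hL' := hL.reverse
    rw [hRr] at hL'
    exact hL'.absurd_of_levels_le (by simpa using hBD) (by simpa using hAD) hP
      (fun e he => ⟨c, by simpa using hc, (hlt e (by simpa using he)).le⟩)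
      (Or.inr fun e he => ⟨c, by simpa using hc, hlt e (by simpa using he)⟩)

lemma dominating_of_noTriangle [Finite V] {G : SimpleGraph V} (hG : G.HasCrossingEdges)
    (hT : G.NoTriangle) (hS : G.NoSpider) {x₀ : V} {R₀ : List V}
    (hC : G.IsListCycle x₀ R₀)
    (hlong : ∀ x' R', G.IsListCycle x' R' → R'.length ≤ R₀.length)
    (hoff : ∀ x' R', G.IsListCycle x' R' → R'.length = R₀.length →
      G.offPairs (x₀ :: R₀) ≤ G.offPairs (x' :: R')) {u v : V} (huv : G.Adj u v)
    (hu : u ∉ x₀ :: R₀) (hv : v ∉ x₀ :: R₀) : False := by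
  classical
  let K : SimpleGraph V :=
    { Adj := fun a b => G.Adj a b ∧ a ∉ x₀ :: R₀ ∧ b ∉ x₀ :: R₀
      symm := ⟨fun a b h => ⟨h.1.symm, h.2.2, h.2.1⟩⟩
      loopless := ⟨fun a h => h.1.ne rfl⟩ }
  have hKadj : ∀ h, K.Reachable u h → ∃ h', K.Adj h h' := by
    intro h hr
    obtain ⟨q⟩ := hr.symm
    cases q with
    | nil => exact ⟨v, huv, hu, hv⟩
    | cons h' _ => exact ⟨_, h'⟩
  refine absurd_of_uncovered_set (H := {t | K.Reachable u t}) hG hT hS hC hlong hoff ?_ ?_ ?_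
    ⟨u, Reachable.refl u⟩ ?_
  · intro h hr
    obtain ⟨h', hh'⟩ := hKadj h hr
    exact hh'.2.1
  · intro h hr t hht
    obtain ⟨h', hh'⟩ := hKadj h hr
    by_cases ht : t ∈ x₀ :: R₀
    · exact Or.inr ht
    · exact Or.inl (Reachable.trans hr (Adj.reachable (G := K) ⟨hht, hh'.2.1, ht⟩))
  · intro h hr
    obtain ⟨h', hh'⟩ := hKadj h hr
    exact ⟨h', Reachable.trans hr hh'.reachable, hh'.1⟩
  · intro a ha b hb
    obtain ⟨q⟩ := (Reachable.symm ha).trans hb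
    have hq := q.toPath.2
    refine ⟨q.toPath.1.support, by simp, hq.support_nodup,
      q.toPath.1.isChain_adj_support.imp fun _ _ h => h.1, ?_, ?_, ?_⟩
    · intro c hc
      exact Reachable.trans ha ⟨q.toPath.1.takeUntil c hc⟩
    · rw [List.head?_eq_some_head (by simp)]; simp
    · rw [List.getLast?_eq_some_getLast (by simp)]; simp

/-! ### Graphs with a triangle -/

/-- A vertex adjacent to one corner of a triangle is adjacent to another one. -/
def NoPaw (G : SimpleGraph V) : Prop :=
  ∀ ⦃a b c d : V⦄, G.Adj a b → G.Adj a c → G.Adj b c → G.Adj a d → d ≠ b → d ≠ c →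
    G.Adj d b ∨ G.Adj d c

lemma IsInducedFree.noPaw {G : SimpleGraph V} (hG : G.IsInducedFree triangleOnePendant) :
    G.NoPaw := by
  intro a b c d h1 h2 h3 h4 n1 n2
  by_contra! hcon
  obtain ⟨m1, m2⟩ := hcon
  rw [G.adj_comm] at m1 m2
  apply hG
  let F : Fin 4 → V := ![a, b, c, d]
  have aux : ∀ i j : Fin 4, i < j →
      (G.Adj (F i) (F j) ↔ triangleOnePendant.Adj i j) ∧ F i ≠ F j := by
    have k1 := h1.ne
    have k2 := h2.ne
    have k3 := h3.ne
    have k4 := h4.ne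
    intro i j hij
    fin_cases i <;> fin_cases j <;>
      first
      | (exfalso; revert hij; decide)
      | (simp [F, triangleOnePendant, *]; done)
      | simp [F, triangleOnePendant, n1.symm, n2.symm, *]
  have key : ∀ i j, G.Adj (F i) (F j) ↔ triangleOnePendant.Adj i j := by
    intro i j
    rcases lt_trichotomy i j with h | rfl | h
    · exact (aux i j h).1
    · simp
    · rw [G.adj_comm, triangleOnePendant.adj_comm]; exact (aux j i h).1
  have inj : Function.Injective F := by
    intro i j hij
    rcases lt_trichotomy i j with h | h | h
    · exact absurd hij (aux i j h).2
    · exact h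
    · exact absurd hij.symm (aux j i h).2
  exact ⟨⟨⟨F, inj⟩, fun {i j} => key i j⟩⟩

/-- Adjacency to a given triangle spreads along edges: a vertex outside a triangle with a neighbour
in it has two there, hence forms a new triangle with them. So every triangle touches every vertex,
every vertex lies in a triangle, and so does every edge. A vertex adjacent only to the third corner
over `a` and `b` would give a paw. -/
lemma NoPaw.adj_or_adj {G : SimpleGraph V} (hG : G.HasCrossingEdges) (hP : G.NoPaw)
    (hT : ¬ G.NoTriangle) {a b v : V} (hab : G.Adj a b) (hva : v ≠ a) (hvb : v ≠ b) :
    G.Adj v a ∨ G.Adj v b := by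
  have touch : ∀ {a b c : V}, G.Adj a b → G.Adj b c → G.Adj a c → ∀ v,
      G.Adj v a ∨ G.Adj v b ∨ G.Adj v c := by
    intro a b c hab hbc hac v
    by_contra hv
    obtain ⟨d, hd, e, he, -, -, hde⟩ := hG a {v | G.Adj v a ∨ G.Adj v b ∨ G.Adj v c}
      ⟨b, Or.inl hab.symm, hab.ne'⟩ ⟨v, hv, by rintro rfl; exact hv (Or.inr (Or.inl hab))⟩
    simp only [Set.mem_ofPred_eq, not_or] at hd he
    obtain ⟨e1, e2, e3⟩ := he
    have ea : e ≠ a := by rintro rfl; exact e2 hab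
    have eb : e ≠ b := by rintro rfl; exact e3 hbc
    have ec : e ≠ c := by rintro rfl; exact e1 hac.symm
    have da : d ≠ a := by rintro rfl; exact e1 hde.symm
    have db : d ≠ b := by rintro rfl; exact e2 hde.symm
    have dc : d ≠ c := by rintro rfl; exact e3 hde.symm
    have two : ∀ {p q : V}, G.Adj p q → G.Adj d p → G.Adj d q → e ≠ p → e ≠ q →
        G.Adj e p ∨ G.Adj e q := fun hpq hdp hdq h1 h2 => hP hdp hdq hpq hde h1 h2
    have hpair : (G.Adj d a ∧ G.Adj d b) ∨ (G.Adj d a ∧ G.Adj d c) ∨ (G.Adj d b ∧ G.Adj d c) := by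
      rcases hd with h | h | h
      · have := hP hab hac hbc h.symm db dc
        tauto
      · have := hP hab.symm hbc hac h.symm da dc
        tauto
      · have := hP hac.symm hbc.symm hab h.symm da db
        tauto
    rcases hpair with ⟨h1, h2⟩ | ⟨h1, h2⟩ | ⟨h1, h2⟩
    · have := two hab h1 h2 ea eb; tauto
    · have := two hac h1 h2 ea ec; tauto
    · have := two hbc h1 h2 eb ec; tauto
  unfold NoTriangle at hT
  push Not at hT
  obtain ⟨p, q, r, hpq, hqr, hpr⟩ := hT
  have tri : ∀ u, ∃ s t, G.Adj u s ∧ G.Adj u t ∧ G.Adj s t := by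
    intro u
    by_cases hup : u = p
    · exact ⟨q, r, hup ▸ hpq, hup ▸ hpr, hqr⟩
    by_cases huq : u = q
    · exact ⟨p, r, huq ▸ hpq.symm, huq ▸ hqr, hpr⟩
    by_cases hur : u = r
    · exact ⟨p, q, hur ▸ hpr.symm, hur ▸ hqr.symm, hpq⟩
    rcases touch hpq hqr hpr u with h | h | h
    · rcases hP hpq hpr hqr h.symm huq hur with h' | h'
      exacts [⟨p, q, h, h', hpq⟩, ⟨p, r, h, h', hpr⟩]
    · rcases hP hpq.symm hqr hpr h.symm hup hur with h' | h'
      exacts [⟨q, p, h, h', hpq.symm⟩, ⟨q, r, h, h', hqr⟩]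
    · rcases hP hpr.symm hqr.symm hpq h.symm hup huq with h' | h'
      exacts [⟨r, p, h, h', hpr.symm⟩, ⟨r, q, h, h', hqr.symm⟩]
  have common : ∃ c, G.Adj a c ∧ G.Adj b c := by
    obtain ⟨s, t, has, hat, hst⟩ := tri a
    by_cases hbs : b = s
    · exact ⟨t, hat, hbs ▸ hst⟩
    by_cases hbt : b = t
    · exact ⟨s, has, hbt ▸ hst.symm⟩
    rcases hP has hat hst hab hbs hbt with h | h
    exacts [⟨s, has, h⟩, ⟨t, hat, h⟩]
  obtain ⟨c, hac, hbc⟩ := common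
  rcases touch hab hbc hac v with h | h | h
  · exact Or.inl h
  · exact Or.inr h
  · exact hP hac.symm hbc.symm hab h.symm hva hvb

/-- Apply the hypothesis to `u` and `v` against a cycle edge `xr`, and to `x` and `r` against `uv`.
Either one of `u`, `v` sees both `x` and `r`, or they see one each; both ways the edge `xr` can be
lengthened. -/
lemma dominating_of_adj_or_adj {G : SimpleGraph V}
    (hG : ∀ {a b v : V}, G.Adj a b → v ≠ a → v ≠ b → G.Adj v a ∨ G.Adj v b)
    {x : V} {R : List V} (hC : G.IsListCycle x R)
    (hlong : ∀ x' R', G.IsListCycle x' R' → R'.length ≤ R.length) {u v : V} (huv : G.Adj u v)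
    (hu : u ∉ x :: R) (hv : v ∉ x :: R) : False := by
  obtain ⟨r, R, rfl⟩ : ∃ r R', R = r :: R' := by
    cases R with
    | nil => simp [IsListCycle] at hC
    | cons c R₁ => exact ⟨c, R₁, rfl⟩
  have hxr : G.Adj x r := (hC.2.2 : List.IsChain G.Adj (x :: r :: (R ++ [x]))).rel
  have one : ∀ {t}, t ∉ x :: r :: R → G.Adj t x → ¬ G.Adj t r := by
    intro t ht h1 h2
    have := hlong x (t :: r :: R) ⟨?_, by simp, ?_⟩
    · simp at this
    · have := hC.1
      simp only [List.nodup_cons, List.mem_cons, not_or] at this ht ⊢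
      have e := Ne.symm ht.1
      tauto
    · have := hC.2.2
      simp only [List.cons_append, List.isChain_cons_cons] at this ⊢
      exact ⟨h1.symm, h2, this.2⟩
  have two : ∀ {s t}, G.Adj s t → s ∉ x :: r :: R → t ∉ x :: r :: R → G.Adj s x →
      ¬ G.Adj t r := by
    intro s t hst hs ht h1 h2
    have := hlong x (s :: t :: r :: R) ⟨?_, by simp, ?_⟩
    · simp at this
    · have := hC.1
      simp only [List.nodup_cons, List.mem_cons, not_or] at this hs ht ⊢
      have e := Ne.symm ht.1
      have e' := Ne.symm hs.1
      have e'' := hst.ne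
      tauto
    · have := hC.2.2
      simp only [List.cons_append, List.isChain_cons_cons] at this ⊢
      exact ⟨h1.symm, hst, h2, this.2⟩
  have ne : ∀ {s t}, s ∉ x :: r :: R → t ∈ x :: r :: R → s ≠ t := by
    rintro s t hs ht rfl
    exact hs ht
  have hu' := hG hxr (ne hu (by simp)) (ne hu (by simp))
  have hv' := hG hxr (ne hv (by simp)) (ne hv (by simp))
  have hr := hG huv (ne hu (by simp : r ∈ _)).symm (ne hv (by simp)).symm
  have hx := hG huv (ne hu (by simp : x ∈ _)).symm (ne hv (by simp)).symm
  rw [G.adj_comm r u, G.adj_comm r v] at hr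
  rw [G.adj_comm x u, G.adj_comm x v] at hx
  have := one hu
  have := one hv
  have := two huv hu hv
  have := two huv.symm hv hu
  tauto

/-! ### The theorem -/

/-- Otherwise `G` is a tree, and the neighbour of a leaf is a cut vertex. -/
lemma IsKConnected.exists_isCycle [Fintype V] {G : SimpleGraph V} (h : G.IsKConnected 2) :
    ∃ (x : V) (C : G.Walk x x), C.IsCycle := by
  classical
  by_contra! hcon
  have hcross := h.hasCrossingEdges
  have hac : G.IsAcyclic := fun x C hC => hcon x C hC
  have : Nontrivial V := Fintype.one_lt_card_iff_nontrivial.1 (by have := h.1; omega)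
  have hconn : G.Connected := by
    have := h.2 ∅ (by simp)
    have e : {v : V | v ∉ (∅ : Finset V)} = Set.univ := by simp
    rw [e] at this
    exact (induceUnivIso G).connected_iff.1 this
  obtain ⟨v, hv⟩ := (IsTree.mk hconn hac).exists_vert_degree_one_of_nontrivial
  rw [degree_eq_one_iff_existsUnique_adj] at hv
  obtain ⟨u, hvu, huniq⟩ := hv
  obtain ⟨t, ht⟩ : ∃ t, t ∉ ({v, u} : Finset V) := by
    by_contra! hall
    have h1 : Fintype.card V ≤ ({v, u} : Finset V).card :=
      Finset.card_le_card fun x _ => hall x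
    have h2 := Finset.card_le_two (a := v) (b := u)
    have := h.1
    omega
  simp only [Finset.mem_insert, Finset.mem_singleton, not_or] at ht
  obtain ⟨a, ha, b, -, -, hbu, hab⟩ := hcross u {v} ⟨v, rfl, hvu.ne⟩ ⟨t, ht.1, ht.2⟩
  rw [Set.mem_singleton_iff.1 ha] at hab
  exact hbu (huniq b hab)

/-- There is a longest cycle which, among the longest cycles, leaves the fewest edges uncovered. -/
lemma exists_longest_offPairs_le [Fintype V] {G : SimpleGraph V}
    (h : ∃ x R, G.IsListCycle x R) :
    ∃ x R, G.IsListCycle x R ∧ (∀ x' R', G.IsListCycle x' R' → R'.length ≤ R.length) ∧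
      ∀ x' R', G.IsListCycle x' R' → R'.length = R.length →
        G.offPairs (x :: R) ≤ G.offPairs (x' :: R') := by
  classical
  let S : Set (V × List V) := {c | G.IsListCycle c.1 c.2}
  have hbound : ∀ c ∈ S, c.2.length ≤ Fintype.card V := by
    intro c hc
    have := hc.1.length_le_card
    simp only [List.length_cons] at this
    omega
  obtain ⟨x₀, R₀, h₀⟩ := h
  -- Minimising the difference maximises the length; `hbound` keeps the subtraction from truncating.
  obtain ⟨c₁, hc₁, hmin₁⟩ := exists_minimalFor_of_wellFoundedLT (· ∈ S)
    (fun c => Fintype.card V - c.2.length) ⟨(x₀, R₀), h₀⟩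
  have hlong : ∀ c ∈ S, c.2.length ≤ c₁.2.length := by
    intro c hc
    by_contra! hlt
    have h1 := hbound c hc
    have h2 := hbound c₁ hc₁
    have := hmin₁ hc (by simp only; omega)
    simp only at this
    omega
  obtain ⟨c₂, ⟨hc₂, hl₂⟩, hmin₂⟩ := exists_minimalFor_of_wellFoundedLT
    (fun c => c ∈ S ∧ c.2.length = c₁.2.length) (fun c => G.offPairs (c.1 :: c.2))
    ⟨c₁, hc₁, rfl⟩
  refine ⟨c₂.1, c₂.2, hc₂, fun x' R' h' => hl₂ ▸ hlong (x', R') h', fun x' R' h' hl => ?_⟩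
  rcases le_total (G.offPairs (c₂.1 :: c₂.2)) (G.offPairs (x' :: R')) with hle | hle
  · exact hle
  · exact hmin₂ (j := (x', R')) ⟨h', hl.trans hl₂⟩ hle

end SimpleGraph

theorem theorem5 {V : Type*} [Fintype V] (G : SimpleGraph V)
    (h_conn : G.IsKConnected 2)
    (h_claw : G.IsInducedFree clawTwoPendant)
    (h_tri : G.IsInducedFree triangleOnePendant) :
    ∃ (v : V) (C : G.Walk v v), G.IsLongestCycle C ∧ G.IsDominatingCycle C := by
  have hcross := h_conn.hasCrossingEdges
  obtain ⟨x₀, C₀, hC₀⟩ := h_conn.exists_isCycle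
  obtain ⟨R₀, hR₀, -⟩ := hC₀.exists_isListCycle
  obtain ⟨x, R, hC, hlong, hoff⟩ := SimpleGraph.exists_longest_offPairs_le ⟨x₀, R₀, hR₀⟩
  obtain ⟨C, hCc, hCl, hCs⟩ := hC.exists_walk
  refine ⟨x, C, ⟨hCc, fun w D hD => ?_⟩, hCc, fun e he => ?_⟩
  · obtain ⟨R', hR', hl⟩ := hD.exists_isListCycle
    have := hlong w R' hR'
    omega
  · induction e with
    | h u v =>
      by_contra! hcon
      have hu : u ∉ x :: R := fun h => hcon u ((hCs u).2 h) (by simp)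
      have hv : v ∉ x :: R := fun h => hcon v ((hCs v).2 h) (by simp)
      by_cases hT : G.NoTriangle
      · exact SimpleGraph.dominating_of_noTriangle hcross hT (h_claw.noSpider hT) hC hlong hoff he
          hu hv
      · exact SimpleGraph.dominating_of_adj_or_adj
          (fun hab hva hvb => h_tri.noPaw.adj_or_adj hcross hT hab hva hvb) hC hlong he hu hv
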